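/- Let $\ell\in\mathbb N$. Sequences $\phi_1,\dots,\phi_\ell:\mathbb N\to\mathbb Z$ are called adequate if $\lim_{n\to\infty}|\phi_j(n)|=\infty$ for every $j\in\{1,\dots,\ell\}$ and, for all $a_1,\dots,a_\ell\in\mathbb Z$, the limit $\lim_{n\to\infty}\bigl|\sum_{j=1}^\ell a_j\phi_j(n)\bigr|$ exists and lies in $\{0,\infty\}$. Let $\phi_1,\dots,\phi_\ell$ be adequate sequences, let $G$ be a subgroup of $\mathbb Z^\ell$, and let $\mathcal H$ be an infinite-dimensional complex Hilbert space. Then the following statements are equivalent. (i) $G$ is a group of rigidity for $\phi_1,\dots,\phi_\ell$: there exist a strictly increasing sequence $(n_k)_{k\in\mathbb N}$ in $\mathbb N$ and a unitary operator $U:\mathcal H\to\mathcal H$ such that $$G=\Bigl\{(a_1,\dots,a_\ell)\in\mathbb Z^\ell \;:\; \lim_{k\to\infty}\bigl\|U^{\sum_{j=1}^\ell a_j\phi_j(n_k)}f-f\bigr\|=0\ \text{ for all } f\in\mathcal H\Bigr\}.$$ (iii') There exist a strictly increasing sequence $(n_k)_{k\in\mathbb N}$ in $\mathbb N$ and a unitary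 operator $U:\mathcal H\to\mathcal H$ such that for every $f\in\mathcal H$ and every $(a_1,\dots,a_\ell)\in\mathbb Z^\ell$, in the weak topology of $\mathcal H$, $$\lim_{k\to\infty}U^{\sum_{j=1}^\ell a_j\phi_j(n_k)}f=\begin{cases} f & \text{if }(a_1,\dots,a_\ell)\in G,\\ 0 & \text{if }(a_1,\dots,a_\ell)\notin G.\end{cases}$$ (iv') There exist a strictly increasing sequence $(n_k)_{k\in\mathbb N}$ in $\mathbb N$, a unitary operator $U:\mathcal H\to\mathcal H$ and a non-zero vector $f\in\mathcal H$ such that for every $(a_1,\dots,a_\ell)\in\mathbb Z^\ell$, $$\lim_{k\to\infty}\bigl\langle U^{\sum_{j=1}^\ell a_j\phi_j(n_k)}f,f\bigr\rangle=\begin{cases} \|f\|^2 & \text{if }(a_1,\dots,a_\ell)\in G,\\ 0 & \text{if }(a_1,\dots,a_\ell)\notin G.\end{cases}$$ -/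

import Mathlib

open Filter Topology

noncomputable section

/-- The integer sequence `n ↦ a₁ φ₁(n) + ⋯ + a_ℓ φ_ℓ(n)`. -/
def linComb {ℓ : ℕ} (φ : Fin ℓ → ℕ → ℤ) (a : Fin ℓ → ℤ) (n : ℕ) : ℤ :=
  ∑ j, a j * φ j n

/-- The sequences `φ₁, …, φ_ℓ` are adequate: each `|φ_j(n)|` tends to infinity, and for every
integer vector `a` the limit of `|∑ a_j φ_j(n)|` exists and is either `0` or infinity. -/
def Adequate {ℓ : ℕ} (φ : Fin ℓ → ℕ → ℤ) : Prop :=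
  (∀ j, Tendsto (fun n => |φ j n|) atTop atTop) ∧
    ∀ a : Fin ℓ → ℤ,
      Tendsto (fun n => |linComb φ a n|) atTop (𝓝 0) ∨
        Tendsto (fun n => |linComb φ a n|) atTop atTop

section Hilbert

variable (H : Type*) [NormedAddCommGroup H] [InnerProductSpace ℂ H]

/-- The set `H(U, (n_k))` of all integer vectors `a` such that `U ^ (∑ a_j φ_j(n_k))` converges
to the identity strongly. The unitary operators of `H` are the surjective linear isometries
`H ≃ₗᵢ[ℂ] H`; they form a group under composition, so integer powers make sense. -/
def rigiditySet {ℓ : ℕ} (φ : Fin ℓ → ℕ → ℤ) (U : H ≃ₗᵢ[ℂ] H) (n : ℕ → ℕ) : Set (Fin ℓ → ℤ) :=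
  {a | ∀ f : H, Tendsto (fun k => ‖(U ^ linComb φ a (n k)) f - f‖) atTop (𝓝 0)}

/-- `G` is a group of rigidity for `φ₁, …, φ_ℓ` (realised on the Hilbert space `H`). -/
def IsRigidityGroup {ℓ : ℕ} (φ : Fin ℓ → ℕ → ℤ) (G : AddSubgroup (Fin ℓ → ℤ)) : Prop :=
  ∃ n : ℕ → ℕ, StrictMono n ∧ ∃ U : H ≃ₗᵢ[ℂ] H, (G : Set (Fin ℓ → ℤ)) = rigiditySet H φ U n

/-- For one unitary `U` and one sequence `(n_k)`, and for all `f` and `a`, the vectors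
`U ^ (∑ a_j φ_j(n_k)) f` converge in the weak topology of `H`: to `f` if `a ∈ G`,
to `0` if `a ∉ G`. -/
def HasWeakDichotomy {ℓ : ℕ} (φ : Fin ℓ → ℕ → ℤ) (G : AddSubgroup (Fin ℓ → ℤ)) : Prop :=
  ∃ n : ℕ → ℕ, StrictMono n ∧ ∃ U : H ≃ₗᵢ[ℂ] H, ∀ (f : H) (a : Fin ℓ → ℤ),
    (a ∈ G → Tendsto (fun k => toWeakSpace ℂ H ((U ^ linComb φ a (n k)) f)) atTop
      (𝓝 (toWeakSpace ℂ H f))) ∧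
    (a ∉ G → Tendsto (fun k => toWeakSpace ℂ H ((U ^ linComb φ a (n k)) f)) atTop
      (𝓝 (toWeakSpace ℂ H 0)))

/-- For one unitary `U`, one sequence `(n_k)` and one non-zero vector `f`, and for all `a`, the
correlations `⟨U ^ (∑ a_j φ_j(n_k)) f, f⟩` converge: to `‖f‖²` if `a ∈ G`, to `0` if `a ∉ G`. -/
def HasCorrelationDichotomy {ℓ : ℕ} (φ : Fin ℓ → ℕ → ℤ) (G : AddSubgroup (Fin ℓ → ℤ)) : Prop :=
  ∃ n : ℕ → ℕ, StrictMono n ∧ ∃ U : H ≃ₗᵢ[ℂ] H, ∃ f : H, f ≠ 0 ∧ ∀ a : Fin ℓ → ℤ,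
    (a ∈ G → Tendsto (fun k => inner ℂ ((U ^ linComb φ a (n k)) f) f) atTop
      (𝓝 ((‖f‖ ^ 2 : ℝ) : ℂ))) ∧
    (a ∉ G → Tendsto (fun k => inner ℂ ((U ^ linComb φ a (n k)) f) f) atTop (𝓝 (0 : ℂ)))

end Hilbert

end

universe u

/-! All three statements are equivalent to `K ≤ G`, where `K = relationModule φ`. For `a ∈ K` the
exponents eventually vanish, so (i) or (iv') forces `a ∈ G`. Conversely, from `K ≤ G` one builds a
positive definite `s : ℤ → ℂ` with `s 0 = 1` such that `s (m + ∑ b_j φ_j(n_k))` tends to `s m` if `b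
∈ G` and to `0` otherwise (`exists_autocorrelation`).

Start from the delta function and repeatedly replace a vector by its normalised average over shifts
`∑ a_j φ_j(n)`, with `a` in a large box of representatives of `G ⧸ K`. By adequacy, shifts in
distinct classes mod `K` are far apart for large `n`. The old autocorrelation thus survives near
`0`, and near `∑ b_j φ_j(n)` it reappears scaled by the overlap of the box with its translate by
`b`: nearly `1` if `b ∈ G`, exactly `0` otherwise.

The limit `s` gives a Gram matrix on `ι × ℤ`; the shift on the resulting Hilbert space is the
required unitary. With `ι` indexing a Hilbert basis of `H`, this space is isometric to `H`. -/

/-- The vectors `a` for which `∑ a_j φ_j(n)` vanishes for all large `n`. -/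
def relationModule {ℓ : ℕ} (φ : Fin ℓ → ℕ → ℤ) : Submodule ℤ (Fin ℓ → ℤ) where
  carrier := {a | ∀ᶠ n in atTop, linComb φ a n = 0}
  zero_mem' := by simp [linComb]
  add_mem' {a b} ha hb := by
    filter_upwards [ha, hb] with n h1 h2
    simp only [linComb, Pi.add_apply, add_mul, Finset.sum_add_distrib] at *
    simp [h1, h2]
  smul_mem' c a ha := by
    filter_upwards [ha] with n h1
    simp only [linComb, Pi.smul_apply, smul_eq_mul, mul_assoc, ← Finset.mul_sum] at *
    simp [h1]

lemma mem_relationModule {ℓ : ℕ} {φ : Fin ℓ → ℕ → ℤ} {a : Fin ℓ → ℤ} :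
    a ∈ relationModule φ ↔ ∀ᶠ n in atTop, linComb φ a n = 0 := Iff.rfl

lemma linComb_add {ℓ : ℕ} (φ : Fin ℓ → ℕ → ℤ) (a b : Fin ℓ → ℤ) (n : ℕ) :
    linComb φ (a + b) n = linComb φ a n + linComb φ b n := by
  simp [linComb, add_mul, Finset.sum_add_distrib]

lemma linComb_sub {ℓ : ℕ} (φ : Fin ℓ → ℕ → ℤ) (a b : Fin ℓ → ℤ) (n : ℕ) :
    linComb φ (a - b) n = linComb φ a n - linComb φ b n := by
  simp [linComb, sub_mul, Finset.sum_sub_distrib]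

lemma linComb_neg {ℓ : ℕ} (φ : Fin ℓ → ℕ → ℤ) (a : Fin ℓ → ℤ) (n : ℕ) :
    linComb φ (-a) n = -linComb φ a n := by
  simp [linComb]

lemma linComb_smul {ℓ : ℕ} (φ : Fin ℓ → ℕ → ℤ) (c : ℤ) (a : Fin ℓ → ℤ) (n : ℕ) :
    linComb φ (c • a) n = c * linComb φ a n := by
  simp [linComb, mul_assoc, ← Finset.mul_sum]

lemma mem_relationModule_of_smul_mem {ℓ : ℕ} {φ : Fin ℓ → ℕ → ℤ} {c : ℤ} (hc : c ≠ 0)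
    {a : Fin ℓ → ℤ} (h : c • a ∈ relationModule φ) : a ∈ relationModule φ := by
  rw [mem_relationModule] at *
  filter_upwards [h] with n hn
  rw [linComb_smul] at hn
  exact (mul_eq_zero.1 hn).resolve_left hc

lemma Adequate.tendsto_abs_linComb {ℓ : ℕ} {φ : Fin ℓ → ℕ → ℤ} (hφ : Adequate φ)
    {a : Fin ℓ → ℤ} (ha : a ∉ relationModule φ) :
    Tendsto (fun n => |linComb φ a n|) atTop atTop := by
  refine (hφ.2 a).resolve_left fun h => ha ?_
  rw [nhds_discrete, tendsto_pure] at h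
  filter_upwards [h] with n hn
  exact abs_eq_zero.1 hn

/-! ### Coordinates on `G ⧸ K` and almost invariant boxes -/

/-- If `A ⧸ K` is torsion-free, a basis of `G ⧸ K` lifts to coordinates on `G` modulo `K`. -/
lemma exists_coordinates_mod {A : Type*} [AddCommGroup A] [Module.Finite ℤ A]
    (K G : Submodule ℤ A) (hK : ∀ (c : ℤ) (a : A), c ≠ 0 → c • a ∈ K → a ∈ K) :
    ∃ (r : ℕ) (σ : (Fin r → ℤ) → A), (∀ c, σ c ∈ G) ∧
      ∀ b ∈ G, ∃ β : Fin r → ℤ, ∀ c d, b + σ c - σ d ∈ K ↔ d = c + β := by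
  have : Module.IsTorsionFree ℤ (A ⧸ K) := by
    refine Module.IsTorsionFree.of_smul_eq_zero fun c x h => ?_
    obtain ⟨a, rfl⟩ := K.mkQ_surjective x
    by_cases hc : c = 0
    · exact Or.inl hc
    · refine Or.inr ?_
      rw [← map_smul, Submodule.mkQ_apply, Submodule.Quotient.mk_eq_zero] at h
      rw [Submodule.mkQ_apply, Submodule.Quotient.mk_eq_zero]
      exact hK c a hc h
  -- The image of `G` in `A ⧸ K` is finitely generated and torsion-free, hence free over `ℤ`.
  let w := Module.finBasis ℤ (G.map K.mkQ)
  have hw : ∀ i, ∃ v ∈ G, K.mkQ v = w i := fun i => (Submodule.mem_map.1 (w i).2)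
  choose v hvG hv using hw
  refine ⟨_, fun c => ∑ i, c i • v i,
    fun c => G.sum_mem fun i _ => G.smul_mem _ (hvG i), fun b hb => ?_⟩
  refine ⟨w.equivFun ⟨K.mkQ b, Submodule.mem_map_of_mem hb⟩, fun c d => ?_⟩
  have key : ∀ c : Fin _ → ℤ,
      K.mkQ (∑ i, c i • v i) = ((w.equivFun.symm c : G.map K.mkQ) : A ⧸ K) := by
    intro c
    simp [Module.Basis.equivFun_symm_apply, hv, -Submodule.mkQ_apply]
  rw [← Submodule.Quotient.mk_eq_zero, ← Submodule.mkQ_apply, map_sub, map_add, key, key,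
    sub_eq_zero, eq_comm]
  have : (w.equivFun.symm d : A ⧸ K) = K.mkQ b + (w.equivFun.symm c : A ⧸ K) ↔
      w.equivFun.symm d = ⟨K.mkQ b, Submodule.mem_map_of_mem hb⟩ + w.equivFun.symm c := by
    rw [Subtype.ext_iff]; rfl
  rw [this, LinearEquiv.symm_apply_eq, map_add, LinearEquiv.apply_symm_apply, add_comm]

/-- The discrete box `{0, …, N}^r`. -/
noncomputable def box (r N : ℕ) : Finset (Fin r → ℤ) := Fintype.piFinset fun _ => Finset.Icc 0 (N : ℤ)

lemma box_nonempty (r N : ℕ) : (box r N).Nonempty :=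
  ⟨0, by simp [box]⟩

/-- Large boxes are almost invariant under translation. -/
lemma tendsto_box_ratio (r : ℕ) (β : Fin r → ℤ) :
    Tendsto (fun N => (((box r N).filter fun c => c + β ∈ box r N).card : ℝ) / (box r N).card)
      atTop (𝓝 1) := by
  have h1 : ∀ N : ℕ, ((box r N).filter fun c => c + β ∈ box r N) =
      Fintype.piFinset fun i => Finset.Icc (max 0 (-β i)) (min (N : ℤ) (N - β i)) := by
    intro N
    ext c
    simp only [box, Finset.mem_filter, Fintype.mem_piFinset, Finset.mem_Icc, Pi.add_apply]
    rw [← forall_and]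
    refine forall_congr' fun i => ?_
    omega
  -- The overlap is a product of intervals; the `i`-th has `N + 1 - |β i|` points once `N ≥ |β i|`.
  have h2 : ∀ i, Tendsto (fun N : ℕ =>
      ((Finset.Icc (max 0 (-β i)) (min (N : ℤ) (N - β i))).card : ℝ) /
        (Finset.Icc 0 (N : ℤ)).card) atTop (𝓝 1) := by
    intro i
    have h3 : Tendsto (fun N : ℕ => 1 - (|β i| : ℝ) * (1 / ((N : ℝ) + 1))) atTop (𝓝 1) := by
      simpa using (tendsto_one_div_add_atTop_nhds_zero_nat.const_mul (|β i| : ℝ)).const_sub 1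
    refine h3.congr' ?_
    filter_upwards [eventually_ge_atTop (β i).natAbs] with N hN
    have h4 : ((Finset.Icc (max 0 (-β i)) (min (N : ℤ) (N - β i))).card : ℤ) =
        N + 1 - |β i| := by
      rw [Int.card_Icc]
      rcases abs_cases (β i) with h | h <;> omega
    have h5 : ((Finset.Icc (max 0 (-β i)) (min (N : ℤ) (N - β i))).card : ℝ) =
        N + 1 - |β i| := by exact_mod_cast h4
    rw [h5]
    have : ((Finset.Icc 0 (N : ℤ)).card : ℝ) = N + 1 := by
      rw [Int.card_Icc]; simp
    rw [this]
    have : (N : ℝ) + 1 ≠ 0 := by positivity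
    push_cast
    field_simp
  have h6 := tendsto_finsetProd Finset.univ fun i _ => h2 i
  simp only [Finset.prod_const_one] at h6
  refine h6.congr fun N => ?_
  rw [h1, box, Fintype.card_piFinset, Fintype.card_piFinset]
  push_cast
  rw [Finset.prod_div_distrib]

/-! ### Averaged autocorrelations -/

/-- The autocorrelation of `|B|^{-1/2} ∑_{c ∈ B} T^{ψ c} f`, if `s` is the autocorrelation of `f`
under `T`. -/
noncomputable def avgShift {I : Type*} (B : Finset I) (ψ : I → ℤ) (s : ℤ → ℂ) (m : ℤ) : ℂ :=
  (B.card : ℂ)⁻¹ * ∑ c ∈ B, ∑ d ∈ B, s (m + ψ d - ψ c)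

lemma avgShift_finite_support {I : Type*} (B : Finset I) (ψ : I → ℤ) {s : ℤ → ℂ}
    (hs : s.support.Finite) : (avgShift B ψ s).support.Finite := by
  have : (avgShift B ψ s).support ⊆
      ⋃ c ∈ B, ⋃ d ∈ B, (fun m => m + ψ c - ψ d) '' s.support := by
    intro m hm
    by_contra h
    simp only [Set.mem_iUnion, Set.mem_image, not_exists, not_and] at h
    apply hm
    rw [avgShift, Finset.sum_eq_zero, mul_zero]
    intro c hc
    refine Finset.sum_eq_zero fun d hd => ?_
    by_contra h0
    exact h c hc d hd (m + ψ d - ψ c) h0 (by ring)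
  refine Set.Finite.subset ?_ this
  exact B.finite_toSet.biUnion fun c _ => B.finite_toSet.biUnion fun d _ => hs.image _

/-- `u` is a family of vectors in `H` in which different indices `i` give orthogonal sequences, each
of them with autocorrelation `s`. -/
def IsGram {ι H : Type*} [DecidableEq ι] [NormedAddCommGroup H] [InnerProductSpace ℂ H]
    (u : ι × ℤ → H) (s : ℤ → ℂ) : Prop :=
  ∀ p q, inner ℂ (u p) (u q) = if p.1 = q.1 then s (q.2 - p.2) else 0

lemma IsGram.avgShift {ι H : Type*} [DecidableEq ι] [NormedAddCommGroup H]
    [InnerProductSpace ℂ H] {u : ι × ℤ → H} {s : ℤ → ℂ} (hu : IsGram u s)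
    {I : Type*} (B : Finset I) (ψ : I → ℤ) :
    IsGram (fun p => (((√(B.card : ℝ))⁻¹ : ℝ) : ℂ) • ∑ c ∈ B, u (p.1, p.2 + ψ c))
      (avgShift B ψ s) := by
  intro p q
  rw [inner_smul_left, inner_smul_right, sum_inner]
  simp only [inner_sum, hu _ _]
  rw [Complex.conj_ofReal, ← mul_assoc, ← Complex.ofReal_mul, ← mul_inv,
    Real.mul_self_sqrt (Nat.cast_nonneg _)]
  split_ifs with h
  · simp only [_root_.avgShift]
    push_cast
    congr 1
    refine Finset.sum_congr rfl fun c _ => Finset.sum_congr rfl fun d _ => ?_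
    congr 1
    ring
  · simp

open Classical in
/-- The mean number of `c` in a box with `b + σ d - σ c ∈ K` for `d` in the box. -/
noncomputable def boxRatio {A : Type*} [AddCommGroup A] (K : Submodule ℤ A) {r : ℕ}
    (σ : (Fin r → ℤ) → A) (N : ℕ) (b : A) : ℂ :=
  ((box r N).card : ℂ)⁻¹ * ∑ c ∈ box r N, ∑ d ∈ box r N, if b + σ d - σ c ∈ K then 1 else 0

section

variable {A : Type*} [AddCommGroup A] {K G : Submodule ℤ A} {r : ℕ} {σ : (Fin r → ℤ) → A}

lemma boxRatio_eq_zero (hKG : K ≤ G) (hσ : ∀ c, σ c ∈ G) (N : ℕ) {b : A} (hb : b ∉ G) :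
    boxRatio K σ N b = 0 := by
  rw [boxRatio, Finset.sum_eq_zero, mul_zero]
  refine fun c _ => Finset.sum_eq_zero fun d _ => if_neg fun h => hb ?_
  have := G.add_mem (hKG h) (G.sub_mem (hσ c) (hσ d))
  convert! this using 1
  abel

lemma boxRatio_eq {b : A} {β : Fin r → ℤ} (hβ : ∀ c d, b + σ c - σ d ∈ K ↔ d = c + β) (N : ℕ) :
    boxRatio K σ N b =
      ((((box r N).filter fun c => c + β ∈ box r N).card : ℝ) / (box r N).card : ℝ) := by
  rw [boxRatio, Finset.sum_comm]
  simp only [hβ, Finset.sum_ite_eq']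
  rw [← Finset.sum_filter, Finset.sum_const]
  push_cast
  simp [div_eq_inv_mul]

lemma tendsto_boxRatio {b : A} {β : Fin r → ℤ} (hβ : ∀ c d, b + σ c - σ d ∈ K ↔ d = c + β) :
    Tendsto (fun N => boxRatio K σ N b) atTop (𝓝 1) := by
  simp only [boxRatio_eq hβ]
  exact_mod_cast (Complex.continuous_ofReal.tendsto 1).comp (tendsto_box_ratio r β)

/-- Having exactly `1` here, not merely in the limit, means that averaging leaves the values of `s`
already fixed near the origin unchanged. -/
lemma boxRatio_zero {β : Fin r → ℤ} (hβ : ∀ c d, 0 + σ c - σ d ∈ K ↔ d = c + β) (N : ℕ) :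
    boxRatio K σ N 0 = 1 := by
  have h0 : β = 0 := by
    have := (hβ 0 0).1 (by simp)
    simpa using this.symm
  subst h0
  rw [boxRatio_eq hβ]
  have : ((box r N).card : ℝ) ≠ 0 := by exact_mod_cast (box_nonempty r N).card_pos.ne'
  simp [this]

end

open Classical in
/-- Far out, averaging along `φ(n)` does not affect `s` near the origin, and multiplies it by
`boxRatio` near the integers `∑ b_j φ_j(n)`. -/
lemma eventually_avgShift_eq {ℓ : ℕ} {φ : Fin ℓ → ℕ → ℤ} (hφ : Adequate φ)
    {s : ℤ → ℂ} (hs : s.support.Finite) {r : ℕ}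
    (σ : (Fin r → ℤ) → Fin ℓ → ℤ) (N : ℕ) (A : Finset (Fin ℓ → ℤ)) (R : ℤ) :
    ∀ᶠ n in atTop, ∀ b ∈ A, ∀ m : ℤ, |m| ≤ R →
      avgShift (box r N) (fun c => linComb φ (σ c) n) s (m + linComb φ b n) =
        boxRatio (relationModule φ) σ N b * s m := by
  obtain ⟨S, hS⟩ : ∃ S : ℤ, ∀ m, S < |m| → s m = 0 := by
    obtain ⟨S, hS⟩ := (hs.image fun m => |m|).bddAbove
    refine ⟨S, fun m hm => ?_⟩
    by_contra h
    exact absurd (hS ⟨m, h, rfl⟩) (not_le.2 hm)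
  -- By adequacy, a shift either eventually vanishes or pushes the window `|m| ≤ R` out of the
  -- support of `s`.
  have key : ∀ a : Fin ℓ → ℤ, ∀ᶠ n in atTop, ∀ m : ℤ, |m| ≤ R →
      s (m + linComb φ a n) = if a ∈ relationModule φ then s m else 0 := by
    intro a
    by_cases ha : a ∈ relationModule φ
    · filter_upwards [mem_relationModule.1 ha] with n hn m _
      simp [ha, hn]
    · filter_upwards [(hφ.tendsto_abs_linComb ha).eventually_gt_atTop (S + R)] with n hn m hm
      rw [if_neg ha]
      apply hS
      have := abs_sub_abs_le_abs_sub (linComb φ a n) (-m)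
      rw [abs_neg, sub_neg_eq_add, add_comm (linComb φ a n)] at this
      linarith
  have h2 : ∀ᶠ n in atTop, ∀ b ∈ A, ∀ c ∈ box r N, ∀ d ∈ box r N, ∀ m : ℤ, |m| ≤ R →
      s (m + linComb φ (b + σ d - σ c) n) =
        if b + σ d - σ c ∈ relationModule φ then s m else 0 := by
    rw [Filter.eventually_all_finset]; intro b _
    rw [Filter.eventually_all_finset]; intro c _
    rw [Filter.eventually_all_finset]; intro d _
    exact key _
  filter_upwards [h2] with n hn b hb m hm
  rw [avgShift, boxRatio, mul_assoc]
  congr 1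
  rw [Finset.sum_mul]
  refine Finset.sum_congr rfl fun c hc => ?_
  rw [Finset.sum_mul]
  refine Finset.sum_congr rfl fun d hd => ?_
  rw [ite_mul, one_mul, zero_mul]
  convert! hn b hb c hc d hd m hm using 2
  rw [linComb_sub, linComb_add]
  ring

/-- A sequence along which an autocorrelation function shows the dichotomy prescribed by `G`. -/
theorem exists_autocorrelation {ℓ : ℕ} {φ : Fin ℓ → ℕ → ℤ} (hφ : Adequate φ) {ι H : Type*} [DecidableEq ι] [NormedAddCommGroup H]
    [InnerProductSpace ℂ H] {u : ι × ℤ → H} (hu : Orthonormal ℂ u)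
    {G : Submodule ℤ (Fin ℓ → ℤ)} (hKG : relationModule φ ≤ G) :
    ∃ (n : ℕ → ℕ) (s : ℤ → ℂ) (v : ℕ → ι × ℤ → H), StrictMono n ∧ s 0 = 1 ∧
      (∀ p q, Tendsto (fun k => inner ℂ (v k p) (v k q)) atTop
        (𝓝 (if p.1 = q.1 then s (q.2 - p.2) else 0))) ∧
      ∀ b m, (b ∈ G → Tendsto (fun k => s (m + linComb φ b (n k))) atTop (𝓝 (s m))) ∧
        (b ∉ G → Tendsto (fun k => s (m + linComb φ b (n k))) atTop (𝓝 0)) := by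
  obtain ⟨r, σ, hσG, hσ⟩ := exists_coordinates_mod (relationModule φ) G
    fun c a hc h => mem_relationModule_of_smul_mem hc h
  obtain ⟨β₀, hβ₀⟩ := hσ 0 G.zero_mem
  -- Finite sets exhausting `ℤ^ℓ`: stage `k` treats the vectors in `A k`.
  let A : ℕ → Finset (Fin ℓ → ℤ) := fun k => Finset.Icc (fun _ => -(k : ℤ)) (fun _ => (k : ℤ))
  have hA0 : ∀ k, (0 : Fin ℓ → ℤ) ∈ A k := fun k => by
    simp only [A, Finset.mem_Icc, Pi.le_def]
    exact ⟨fun _ => by simp, fun _ => by simp⟩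
  have hA : ∀ b, ∀ᶠ k in atTop, b ∈ A k := fun b => by
    have : ∀ j, ∀ᶠ k : ℕ in atTop, |b j| ≤ k := fun j => by
      filter_upwards [eventually_ge_atTop (b j).natAbs] with k hk
      rw [Int.abs_eq_natAbs]
      exact_mod_cast hk
    filter_upwards [eventually_all.2 this] with k hk
    simp only [A, Finset.mem_Icc, Pi.le_def]
    exact ⟨fun j => (abs_le.1 (hk j)).1, fun j => (abs_le.1 (hk j)).2⟩
  let good : (ℤ → ℂ) → Prop := fun s => s.support.Finite ∧ ∃ v : ι × ℤ → H, IsGram v s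
  -- A state is an autocorrelation, the last time `n` used, and the radius within which values are
  -- frozen.
  let X := {s : ℤ → ℂ // good s} × ℕ × ℤ
  let P : ℕ → X → X → Prop := fun k x y => x.2.1 < y.2.1 ∧ (k : ℤ) + 1 ≤ y.2.2 ∧
    x.2.2 ≤ y.2.2 ∧
    (∀ m : ℤ, |m| ≤ x.2.2 → y.1.1 m = x.1.1 m) ∧
    (∀ b ∈ A k, (k : ℤ) + |linComb φ b y.2.1| ≤ y.2.2) ∧
    ∀ b ∈ A k, ∀ m : ℤ, |m| ≤ x.2.2 →
      y.1.1 (m + linComb φ b y.2.1) = boxRatio (relationModule φ) σ k b * x.1.1 m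
  have step : ∀ k x, ∃ y, P k x y := by
    rintro k ⟨⟨s, hs, v, hv⟩, n, R⟩
    obtain ⟨n', hn', hlt⟩ := ((eventually_avgShift_eq hφ hs σ k (A k) R).and
      (eventually_gt_atTop n)).exists
    -- The sum bounds every `|linComb φ b n'|` at once, so the new radius also freezes the values
    -- just created near these points.
    refine ⟨⟨⟨_, avgShift_finite_support _ _ hs, _, hv.avgShift _ _⟩, n',
      |R| + k + 1 + ∑ b ∈ A k, |linComb φ b n'|⟩, hlt, ?_, ?_, ?_, ?_, hn'⟩
    · have : 0 ≤ ∑ b ∈ A k, |linComb φ b n'| := Finset.sum_nonneg fun _ _ => abs_nonneg _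
      have := abs_nonneg R
      dsimp only
      linarith
    · have : 0 ≤ ∑ b ∈ A k, |linComb φ b n'| := Finset.sum_nonneg fun _ _ => abs_nonneg _
      have := le_abs_self R
      dsimp only
      linarith
    · intro m hm
      have := hn' 0 (hA0 k) m hm
      rw [boxRatio_zero hβ₀, one_mul] at this
      simpa [linComb] using this
    · intro b hb
      have := Finset.single_le_sum (f := fun b => |linComb φ b n'|)
        (fun _ _ => abs_nonneg _) hb
      have := abs_nonneg R
      dsimp only at *
      linarith
  choose F hF using step
  have good0 : good (fun m => if m = 0 then 1 else 0) := by
    refine ⟨(Set.finite_singleton (0 : ℤ)).subset fun m hm => ?_, u, fun p q => ?_⟩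
    · by_contra h
      exact hm (if_neg h)
    · rw [orthonormal_iff_ite.1 hu p q]
      simp only [sub_eq_zero, Prod.ext_iff, eq_comm (a := q.2)]
      split_ifs <;> simp_all
  let x : ℕ → X := fun k => Nat.rec (⟨⟨_, good0⟩, 0, 0⟩ : X) F k
  have hx : ∀ k, P k (x k) (x (k + 1)) := fun k => hF k (x k)
  have hR : ∀ k : ℕ, (k : ℤ) ≤ (x k).2.2 := by
    intro k
    cases k with
    | zero => simp [x]
    | succ k => exact_mod_cast (hx k).2.1
  have hRmono : Monotone fun k => (x k).2.2 := monotone_nat_of_le_succ fun k => (hx k).2.2.1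
  have hst : ∀ k j (m : ℤ), k ≤ j → |m| ≤ (x k).2.2 → (x j).1.1 m = (x k).1.1 m := by
    intro k j m hkj hm
    induction j, hkj using Nat.le_induction with
    | base => rfl
    | succ j hj ih => rw [(hx j).2.2.2.1 m (hm.trans (hRmono hj)), ih]
  -- The radius at stage `k` is at least `k`, so the value at `m` is settled by stage `|m|`.
  let s : ℤ → ℂ := fun m => (x m.natAbs).1.1 m
  have hs : ∀ k (m : ℤ), |m| ≤ (x k).2.2 → s m = (x k).1.1 m := by
    intro k m hm
    have hm' : |m| ≤ (x m.natAbs).2.2 := by simpa using hR m.natAbs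
    rcases le_total k m.natAbs with h | h
    · exact hst k _ m h hm
    · exact (hst _ _ m h hm').symm
  have hsub : ∀ b m, ∀ᶠ k in atTop,
      s (m + linComb φ b (x (k + 1)).2.1) = boxRatio (relationModule φ) σ k b * s m := by
    intro b m
    filter_upwards [hA b, eventually_ge_atTop m.natAbs] with k hk hmk
    have hmk' : |m| ≤ (k : ℤ) := by
      rw [Int.abs_eq_natAbs]
      exact_mod_cast hmk
    rw [hs (k + 1), (hx k).2.2.2.2.2 b hk m (hmk'.trans (hR k)), hs k m (hmk'.trans (hR k))]
    have := (hx k).2.2.2.2.1 b hk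
    have := abs_add_le m (linComb φ b (x (k + 1)).2.1)
    linarith
  choose v hv using fun k => (x k).1.2.2
  refine ⟨fun k => (x (k + 1)).2.1, s, v, strictMono_nat_of_lt_succ fun k => (hx (k + 1)).1,
    by simp [s, x], fun p q => ?_, fun b m => ⟨fun hb => ?_, fun hb => ?_⟩⟩
  · simp only [hv _ p q]
    split_ifs
    · refine tendsto_const_nhds.congr' ?_
      filter_upwards [eventually_ge_atTop (q.2 - p.2).natAbs] with k hk
      refine hs k _ (le_trans ?_ (hR k))
      rw [Int.abs_eq_natAbs]
      exact_mod_cast hk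
    · exact tendsto_const_nhds
  · obtain ⟨β, hβ⟩ := hσ b hb
    have h1 := (tendsto_boxRatio hβ).mul_const (s m)
    rw [one_mul] at h1
    exact h1.congr' ((hsub b m).mono fun k hk => hk.symm)
  · refine tendsto_const_nhds.congr' ((hsub b m).mono fun k hk => ?_)
    dsimp only
    rw [hk, boxRatio_eq_zero hKG hσG k hb, zero_mul]

/-! ### Gram matrices, Hilbert dimension and weak convergence -/

section

variable {H : Type*} [NormedAddCommGroup H] [InnerProductSpace ℂ H]

lemma norm_sq_linearCombination {X : Type*} (w : X → H) (F : X →₀ ℂ) :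
    ((‖Finsupp.linearCombination ℂ w F‖ ^ 2 : ℝ) : ℂ) =
      F.sum fun x a => F.sum fun y b => starRingEnd ℂ a * b * inner ℂ (w x) (w y) := by
  rw [Complex.ofReal_pow]
  refine (inner_self_eq_norm_sq_to_K (𝕜 := ℂ) (Finsupp.linearCombination ℂ w F)).symm.trans ?_
  rw [Finsupp.linearCombination_apply, Finsupp.sum_inner]
  simp only [inner_sum, inner_smul_left, inner_smul_right, Finsupp.sum]
  refine Finset.sum_congr rfl fun x _ => Finset.sum_congr rfl fun y _ => ?_
  ring

/-- Families with dense spans and equal Gram matrices are related by a unitary operator. -/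
lemma exists_linearIsometryEquiv_of_inner_eq [CompleteSpace H] {X : Type*} {w w' : X → H}
    (hw : (Submodule.span ℂ (Set.range w)).topologicalClosure = ⊤)
    (hw' : (Submodule.span ℂ (Set.range w')).topologicalClosure = ⊤)
    (h : ∀ x y, inner ℂ (w x) (w y) = inner ℂ (w' x) (w' y)) :
    ∃ U : H ≃ₗᵢ[ℂ] H, ∀ x, U (w x) = w' x := by
  have dense : ∀ w : X → H, (Submodule.span ℂ (Set.range w)).topologicalClosure = ⊤ →
      DenseRange (Finsupp.linearCombination ℂ w) := by
    intro w hw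
    rw [← Finsupp.range_linearCombination, ← Submodule.dense_iff_topologicalClosure_eq_top] at hw
    exact hw
  have hn : ∀ F : X →₀ ℂ, ‖Finsupp.linearCombination ℂ w' (LinearEquiv.refl ℂ _ F)‖ =
      ‖Finsupp.linearCombination ℂ w F‖ := by
    intro F
    rw [← sq_eq_sq₀ (norm_nonneg _) (norm_nonneg _)]
    apply Complex.ofReal_injective
    rw [norm_sq_linearCombination, LinearEquiv.refl_apply, norm_sq_linearCombination]
    simp only [h]
  refine ⟨LinearEquiv.extendOfIsometry (LinearEquiv.refl ℂ (X →₀ ℂ)) _ _ (dense w hw)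
    (dense w' hw') hn, fun x => ?_⟩
  have := LinearEquiv.extendOfIsometry_eq (LinearEquiv.refl ℂ (X →₀ ℂ)) _ _ (dense w hw)
    (dense w' hw') hn (Finsupp.single x 1)
  simpa using this

open RKHS in
/-- A limit of Gram matrices is a Gram matrix. -/
lemma exists_family_of_tendsto_inner {X : Type u} {v : ℕ → X → H} {k : X → X → ℂ}
    (h : ∀ x y, Tendsto (fun n => inner ℂ (v n x) (v n y)) atTop (𝓝 (k x y))) :
    ∃ (V : Type u) (_ : NormedAddCommGroup V) (_ : InnerProductSpace ℂ V) (_ : CompleteSpace V)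
      (w : X → V), (∀ x y, inner ℂ (w x) (w y) = k x y) ∧
        (Submodule.span ℂ (Set.range w)).topologicalClosure = ⊤ := by
  -- The scalar kernel is read as an operator-valued one; its reproducing kernel Hilbert space is
  -- the desired space.
  let K : Matrix X X (ℂ →L[ℂ] ℂ) := fun x y => k x y • 1
  have hk : ∀ x y, starRingEnd ℂ (k y x) = k x y := by
    intro x y
    refine tendsto_nhds_unique ((Complex.continuous_conj.tendsto _).comp (h y x)) ?_
    refine (h x y).congr fun n => ?_
    simp
  have hK : K.PosSemidef := by
    have h0 := (posSemidef_tfae (K := K)).out 0 2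
    rw [h0]
    refine ⟨?_, fun F => ?_⟩
    · refine Matrix.IsHermitian.ext fun x y => ?_
      simp only [K, star_smul, star_one, RCLike.star_def, hk]
    -- The quadratic form is a limit of squared norms, hence nonnegative.
    · have h1 : Tendsto (fun n => ((‖Finsupp.linearCombination ℂ (v n) F‖ ^ 2 : ℝ) : ℂ)) atTop
          (𝓝 (F.sum fun x a => F.sum fun y b => starRingEnd ℂ a * b * k x y)) := by
        simp only [norm_sq_linearCombination, Finsupp.sum]
        exact tendsto_finsetSum _ fun x _ => tendsto_finsetSum _ fun y _ =>
          (h x y).const_mul _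
      have h2 := ge_of_tendsto ((Complex.continuous_re.tendsto _).comp h1)
        (Eventually.of_forall fun n => by
          simp only [Function.comp, Complex.ofReal_re]; positivity)
      convert! h2 using 1
      simp [K, hk, mul_comm, mul_left_comm]
  have : Fact K.PosSemidef := ⟨hK⟩
  refine ⟨OfKernel K, inferInstance, inferInstance, inferInstance,
    fun x => kerFun (OfKernel K) x (1 : ℂ), fun x y => ?_, ?_⟩
  · rw [kerFun_inner, kerFun_apply, OfKernel.kernel_ofKernel]
    simp [K]
  · rw [eq_top_iff, ← kerFun_dense (OfKernel K)]
    refine Submodule.topologicalClosure_mono (Submodule.span_le.2 ?_)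
    rintro _ ⟨x, a, rfl⟩
    have : kerFun (OfKernel K) x a = a • kerFun (OfKernel K) x (1 : ℂ) := by
      rw [← map_smul, smul_eq_mul, mul_one]
    rw [this]
    exact Submodule.smul_mem _ _ (Submodule.subset_span ⟨x, rfl⟩)

open Cardinal in
/-- An orthonormal family is not larger than an infinite family with dense span. -/
lemma Orthonormal.mk_le_of_dense_span {ι κ : Type u} [Infinite κ] {v : ι → H}
    (hv : Orthonormal ℂ v) {w : κ → H}
    (hw : (Submodule.span ℂ (Set.range w)).topologicalClosure = ⊤) : #ι ≤ #κ := by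
  have h1 : ∀ i, ∃ k, inner ℂ (v i) (w k) ≠ 0 := by
    intro i
    by_contra! h
    have h2 : v i = 0 := by
      refine Dense.eq_zero_of_inner_left ℂ (Submodule.dense_iff_topologicalClosure_eq_top.2 hw) ?_
      intro x hx
      induction hx using Submodule.span_induction with
      | mem x hx => obtain ⟨k, rfl⟩ := hx; exact h k
      | zero => exact inner_zero_right _
      | add x y _ _ hx hy => exact (inner_add_right _ _ _).trans (by rw [hx, hy, add_zero])
      | smul a x _ hx => exact (inner_smul_right _ _ _).trans (by rw [hx, mul_zero])
    exact hv.ne_zero i h2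
  choose f hf using h1
  -- By Bessel, each `w k` meets only countably many `v i`, so `ι` injects into `κ × ℕ`.
  have h3 : ∀ k, {i | inner ℂ (v i) (w k) ≠ 0}.Countable := by
    intro k
    refine (hv.inner_products_summable (w k)).countable_support.mono fun i hi => ?_
    simpa using hi
  have h4 : ∀ k, ∃ g : ι → ℕ, Set.InjOn g {i | inner ℂ (v i) (w k) ≠ 0} :=
    fun k => Set.countable_iff_exists_injOn.1 (h3 k)
  choose g hg using h4
  have h5 : Function.Injective fun i => ((f i, ULift.up (g (f i) i)) : κ × ULift.{u} ℕ) := by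
    intro i j hij
    simp only [Prod.mk.injEq, ULift.up_inj] at hij
    refine hg (f i) (hf i) (by simpa [hij.1] using hf j) ?_
    rw [hij.2, hij.1]
  refine (mk_le_of_injective h5).trans ?_
  rw [mk_prod, lift_id, lift_id]
  exact mul_le_of_le (aleph0_le_mk κ) le_rfl (by simp)

open Cardinal in
/-- A Hilbert space with an orthonormal family and a family with dense span, both indexed by sets
of the cardinality of a Hilbert basis of `H`, is isometric to `H`. -/
lemma HilbertBasis.nonempty_linearIsometryEquiv {V : Type*} [NormedAddCommGroup V]
    [InnerProductSpace ℂ V] [CompleteSpace V] {ι κ : Type u} [Infinite ι]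
    (b : HilbertBasis ι ℂ H) {B : Type u} (c : HilbertBasis B ℂ V)
    (hκ : #κ = #ι) {v : ι → V} (hv : Orthonormal ℂ v) {w : κ → V}
    (hw : (Submodule.span ℂ (Set.range w)).topologicalClosure = ⊤) :
    Nonempty (V ≃ₗᵢ[ℂ] H) := by
  have : Infinite κ := by
    rw [infinite_iff, hκ]
    exact aleph0_le_mk ι
  have hB : Infinite B := by
    by_contra h
    have : Finite B := not_infinite_iff_finite.1 h
    have := Fintype.ofFinite B
    have : Module.Finite ℂ V := Module.Finite.of_basis c.toOrthonormalBasis.toBasis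
    have := hv.linearIndependent.finite_of_isNoetherian
    exact not_finite ι
  have h1 : #ι = #B := le_antisymm (hv.mk_le_of_dense_span c.dense_span)
    ((c.orthonormal.mk_le_of_dense_span hw).trans hκ.le)
  obtain ⟨e⟩ := Cardinal.eq.1 h1
  have h2 : ⊤ ≤ (Submodule.span ℂ (Set.range (c ∘ e))).topologicalClosure := by
    rw [EquivLike.range_comp, c.dense_span]
  exact ⟨(HilbertBasis.mk (c.orthonormal.comp e e.injective) h2).repr.trans b.repr.symm⟩

/-- A bounded sequence converges weakly if it does so when tested on a dense subspace. -/
lemma tendsto_inner_of_dense_span {S : Set H}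
    (hS : (Submodule.span ℂ S).topologicalClosure = ⊤) {x : ℕ → H} {y : H} {C : ℝ}
    (hC : ∀ k, ‖x k‖ ≤ C) (h : ∀ g ∈ S, Tendsto (fun k => inner ℂ (x k) g) atTop (𝓝 (inner ℂ y g)))
    (g : H) : Tendsto (fun k => inner ℂ (x k) g) atTop (𝓝 (inner ℂ y g)) := by
  have hspan : ∀ g ∈ Submodule.span ℂ S,
      Tendsto (fun k => inner ℂ (x k) g) atTop (𝓝 (inner ℂ y g)) := by
    intro g hg
    induction hg using Submodule.span_induction with
    | mem x hx => exact h x hx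
    | zero => simp
    | add a b _ _ ha hb => simpa only [inner_add_right] using ha.add hb
    | smul c a _ ha => simpa only [inner_smul_right] using ha.const_mul c
  have hC0 : 0 ≤ C := (norm_nonneg _).trans (hC 0)
  rw [Metric.tendsto_atTop]
  intro ε hε
  obtain ⟨g', hg', hd⟩ := (Submodule.dense_iff_topologicalClosure_eq_top.2 hS).exists_dist_lt g
    (ε := ε / (2 * (C + ‖y‖ + 1))) (by positivity)
  obtain ⟨N, hN⟩ := Metric.tendsto_atTop.1 (hspan g' hg') (ε / 2) (by positivity)
  refine ⟨N, fun k hk => ?_⟩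
  have h1 := hN k hk
  rw [dist_eq_norm, ← inner_sub_left] at h1 ⊢
  rw [dist_eq_norm] at hd
  have h2 : inner ℂ (x k - y) g = inner ℂ (x k - y) g' + inner ℂ (x k - y) (g - g') := by
    rw [← inner_add_right, add_sub_cancel]
  have h3 : ‖x k - y‖ ≤ C + ‖y‖ := (norm_sub_le _ _).trans (by linarith [hC k])
  have h4 : ‖inner ℂ (x k - y) (g - g')‖ ≤ ε / 2 := by
    refine (norm_inner_le_norm _ _).trans ?_
    calc ‖x k - y‖ * ‖g - g'‖ ≤ (C + ‖y‖ + 1) * (ε / (2 * (C + ‖y‖ + 1))) := by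
          gcongr
          linarith
      _ = ε / 2 := by
          have : C + ‖y‖ + 1 ≠ 0 := by positivity
          field_simp
  rw [h2]
  exact (norm_add_le _ _).trans_lt (by linarith)

/-- A sequence of unitaries converges weakly to `c • 1` if it does so on a family with dense
span. -/
lemma tendsto_inner_apply_of_dense_span {X : Type*} {w : X → H}
    (hw : (Submodule.span ℂ (Set.range w)).topologicalClosure = ⊤) {T : ℕ → H ≃ₗᵢ[ℂ] H} {c : ℂ}
    (h : ∀ x y, Tendsto (fun k => inner ℂ (T k (w x)) (w y)) atTop
      (𝓝 (inner ℂ (c • w x) (w y)))) (f g : H) :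
    Tendsto (fun k => inner ℂ (T k f) g) atTop (𝓝 (inner ℂ (c • f) g)) := by
  have h1 : ∀ x, Tendsto (fun k => inner ℂ (T k (w x)) g) atTop (𝓝 (inner ℂ (c • w x) g)) :=
    fun x => tendsto_inner_of_dense_span hw (C := ‖w x‖) (fun k => by simp)
      (by rintro _ ⟨y, rfl⟩; exact h x y) g
  -- Passing to adjoints turns density in the second argument into density in the first.
  have h2 : ∀ k f, inner ℂ ((T k).symm g) f = starRingEnd ℂ (inner ℂ (T k f) g) := by
    intro k f
    rw [inner_conj_symm, ← (T k).inner_map_map, LinearIsometryEquiv.apply_symm_apply]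
  have h3 : ∀ f, inner ℂ (starRingEnd ℂ c • g) f = starRingEnd ℂ (inner ℂ (c • f) g) := by
    intro f
    rw [inner_conj_symm, inner_smul_left, inner_smul_right, Complex.conj_conj]
  have h4 := tendsto_inner_of_dense_span (x := fun k => (T k).symm g)
    (y := starRingEnd ℂ c • g) hw (C := ‖g‖) (fun k => by simp) (by
      rintro _ ⟨x, rfl⟩
      simp only [h2, h3]
      exact (Complex.continuous_conj.tendsto _).comp (h1 x)) f
  simp only [h2, h3] at h4
  simpa [Function.comp_def] using (Complex.continuous_conj.tendsto _).comp h4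

lemma tendsto_toWeakSpace_iff [CompleteSpace H] {x : ℕ → H} {y : H} :
    Tendsto (fun k => toWeakSpace ℂ H (x k)) atTop (𝓝 (toWeakSpace ℂ H y)) ↔
      ∀ g, Tendsto (fun k => inner ℂ (x k) g) atTop (𝓝 (inner ℂ y g)) := by
  have h0 : Function.Injective (topDualPairing ℂ H).flip := by
    intro a b hab
    refine ext_inner_left ℂ fun g => ?_
    exact DFunLike.congr_fun hab (InnerProductSpace.toDual ℂ H g)
  refine (WeakBilin.tendsto_iff_forall_eval_tendsto _ h0).trans ?_
  have h1 : ∀ g z, starRingEnd ℂ (inner ℂ z g) = InnerProductSpace.toDual ℂ H g z := by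
    intro g z
    rw [InnerProductSpace.toDual_apply_apply, inner_conj_symm]
  constructor
  · intro h g
    have h2 := (Complex.continuous_conj.tendsto _).comp (h (InnerProductSpace.toDual ℂ H g))
    have h3 : ∀ z, starRingEnd ℂ (InnerProductSpace.toDual ℂ H g z) = inner ℂ z g := fun z => by
      rw [← h1, Complex.conj_conj]
    rw [← h3]
    exact h2.congr fun k => h3 _
  · intro h l
    obtain ⟨g, rfl⟩ := (InnerProductSpace.toDual ℂ H).surjective l
    have h2 := (Complex.continuous_conj.tendsto _).comp (h g)
    rw [h1] at h2
    exact h2.congr fun k => h1 _ _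

end

/-! ### The shift unitary and the implications -/

section

variable {H : Type u} [NormedAddCommGroup H] [InnerProductSpace ℂ H] {ℓ : ℕ}
  {φ : Fin ℓ → ℕ → ℤ} {G : AddSubgroup (Fin ℓ → ℤ)}

lemma LinearIsometryEquiv.zpow_apply_shift {ι : Type*} {U : H ≃ₗᵢ[ℂ] H} {w : ι × ℤ → H}
    (hU : ∀ p, U (w p) = w (p.1, p.2 + 1)) (z : ℤ) (p : ι × ℤ) :
    (U ^ z) (w p) = w (p.1, p.2 + z) := by
  induction z using Int.induction_on generalizing p with
  | zero => simp
  | succ n ih => rw [zpow_add_one, LinearIsometryEquiv.coe_mul, Function.comp_apply, hU, ih]; congr 2; ring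
  | pred n ih =>
    have h1 : U⁻¹ (w p) = w (p.1, p.2 - 1) := by
      have h2 : U (w (p.1, p.2 - 1)) = w p := by rw [hU]; simp
      rw [← h2]
      exact U.symm_apply_apply _
    rw [zpow_sub_one, LinearIsometryEquiv.coe_mul, Function.comp_apply, h1, ih]
    congr 2
    ring

theorem hasWeakDichotomy_of_relationModule_le [CompleteSpace H] (hH : ¬ FiniteDimensional ℂ H)
    (hφ : Adequate φ) (hG : ∀ a ∈ relationModule φ, a ∈ G) : HasWeakDichotomy H φ G := by
  classical
  obtain ⟨S, b, -⟩ := exists_hilbertBasis ℂ H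
  have hS : Infinite S := by
    by_contra h
    have : Finite S := not_infinite_iff_finite.1 h
    have := Fintype.ofFinite S
    exact hH (Module.Finite.of_basis b.toOrthonormalBasis.toBasis)
  have hcard : Cardinal.mk (S × ℤ) = Cardinal.mk S := by
    rw [Cardinal.mk_prod, Cardinal.lift_id', Cardinal.mk_int, Cardinal.lift_aleph0]
    simp
  -- One copy of the shift per element of `S` makes the space exactly as large as `H`.
  obtain ⟨e⟩ := Cardinal.eq.1 hcard
  obtain ⟨n, s, v, hn, hs0, hv, hlim⟩ := exists_autocorrelation hφ
    (b.orthonormal.comp e e.injective) (G := AddSubgroup.toIntSubmodule G) hG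
  obtain ⟨V, _, _, _, w, hw, hdense⟩ := exists_family_of_tendsto_inner hv
  have hw0 : Orthonormal ℂ fun i : S => w (i, 0) := by
    rw [orthonormal_iff_ite]
    intro i j
    simp [hw, hs0]
  obtain ⟨T, c, -⟩ := exists_hilbertBasis ℂ V
  obtain ⟨J⟩ := b.nonempty_linearIsometryEquiv c hcard hw0 hdense
  have hJw : ∀ p q, inner ℂ (J (w p)) (J (w q)) = if p.1 = q.1 then s (q.2 - p.2) else 0 :=
    fun p q => by rw [J.inner_map_map, hw]
  have hJd : (Submodule.span ℂ (Set.range fun p => J (w p))).topologicalClosure = ⊤ := by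
    rw [← Submodule.dense_iff_topologicalClosure_eq_top] at hdense ⊢
    have h1 := J.surjective.denseRange.dense_image J.continuous hdense
    refine h1.mono ?_
    rintro _ ⟨x, hx, rfl⟩
    rw [Set.range_comp' J w]
    exact Submodule.apply_mem_span_image_of_mem_span J.toLinearEquiv.toLinearMap hx
  have hshift : (fun p : S × ℤ => J (w (p.1, p.2 + 1))) =
      (fun p => J (w p)) ∘ (Equiv.prodCongr (Equiv.refl S) (Equiv.addRight (1 : ℤ))) := rfl
  -- The Gram matrix depends only on `q.2 - p.2`, so shifting the index preserves it.
  obtain ⟨U, hU⟩ := exists_linearIsometryEquiv_of_inner_eq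
    (w' := fun p : S × ℤ => J (w (p.1, p.2 + 1))) hJd
    (by rw [hshift, EquivLike.range_comp]; exact hJd) (fun p q => by simp [hJw])
  refine ⟨n, hn, U, fun f a => ⟨fun ha => ?_, fun ha => ?_⟩⟩
  · rw [tendsto_toWeakSpace_iff]
    intro g
    have := tendsto_inner_apply_of_dense_span hJd (T := fun k => U ^ linComb φ a (n k)) (c := 1)
      (fun p q => ?_) f g
    · simpa using this
    simp only [LinearIsometryEquiv.zpow_apply_shift (w := fun p => J (w p)) hU, hJw, one_smul]
    split_ifs
    -- The shift acts on the first argument, so the exponent enters `s` with a minus sign.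
    · exact ((hlim (-a) (q.2 - p.2)).1 (neg_mem ha)).congr fun k => by
        rw [linComb_neg]
        congr 1
        ring
    · exact tendsto_const_nhds
  · rw [tendsto_toWeakSpace_iff]
    intro g
    have := tendsto_inner_apply_of_dense_span hJd (T := fun k => U ^ linComb φ a (n k)) (c := 0)
      (fun p q => ?_) f g
    · simpa using this
    simp only [LinearIsometryEquiv.zpow_apply_shift (w := fun p => J (w p)) hU, hJw, zero_smul,
      inner_zero_left]
    split_ifs
    · exact ((hlim (-a) (q.2 - p.2)).2 fun h => ha (neg_mem_iff.1 h)).congr fun k => by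
        rw [linComb_neg]
        congr 1
        ring
    · exact tendsto_const_nhds

/-- For an isometry, `‖T f - f‖² = 2‖f‖² - 2 Re ⟨T f, f⟩`, so convergence of correlations upgrades
to norm convergence. -/
lemma tendsto_norm_apply_sub {T : ℕ → H ≃ₗᵢ[ℂ] H} {f : H}
    (h : Tendsto (fun k => inner ℂ (T k f) f) atTop (𝓝 (inner ℂ f f))) :
    Tendsto (fun k => ‖T k f - f‖) atTop (𝓝 0) := by
  have h1 : ∀ k, ‖T k f - f‖ ^ 2 = 2 * ‖f‖ ^ 2 - 2 * (inner ℂ (T k f) f).re := by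
    intro k
    rw [@norm_sub_sq ℂ, LinearIsometryEquiv.norm_map]
    simp only [RCLike.re_to_complex]
    ring
  have h2 := (((Complex.continuous_re.tendsto _).comp h).const_mul 2).const_sub (2 * ‖f‖ ^ 2)
  have h3 : (inner ℂ f f : ℂ).re = ‖f‖ ^ 2 := by
    simpa using inner_self_eq_norm_sq (𝕜 := ℂ) f
  rw [h3, sub_self] at h2
  have h4 := (Real.continuous_sqrt.tendsto 0).comp h2
  rw [Real.sqrt_zero] at h4
  refine h4.congr fun k => ?_
  simp only [Function.comp]
  rw [← h1, Real.sqrt_sq (norm_nonneg _)]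

lemma tendsto_inner_of_tendsto_norm_sub {x : ℕ → H} {f : H}
    (h : Tendsto (fun k => ‖x k - f‖) atTop (𝓝 0)) (g : H) :
    Tendsto (fun k => inner ℂ (x k) g) atTop (𝓝 (inner ℂ f g)) :=
  (tendsto_iff_norm_sub_tendsto_zero.2 h).inner tendsto_const_nhds

lemma HasWeakDichotomy.isRigidityGroup [CompleteSpace H] [Nontrivial H]
    (h : HasWeakDichotomy H φ G) : IsRigidityGroup H φ G := by
  obtain ⟨n, hn, U, hU⟩ := h
  refine ⟨n, hn, U, Set.ext fun a => ⟨fun ha f => ?_, fun ha => ?_⟩⟩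
  · exact tendsto_norm_apply_sub (tendsto_toWeakSpace_iff.1 ((hU f a).1 ha) f)
  -- Otherwise a non-zero `f` would give correlations tending both to `⟨f, f⟩` and to `0`.
  · by_contra haG
    obtain ⟨f, hf⟩ := exists_ne (0 : H)
    have h1 := tendsto_toWeakSpace_iff.1 ((hU f a).2 haG) f
    have h2 := tendsto_nhds_unique h1 (tendsto_inner_of_tendsto_norm_sub (ha f) f)
    rw [inner_zero_left] at h2
    exact hf (inner_self_eq_zero.1 h2.symm)

lemma HasWeakDichotomy.hasCorrelationDichotomy [CompleteSpace H] [Nontrivial H]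
    (h : HasWeakDichotomy H φ G) : HasCorrelationDichotomy H φ G := by
  obtain ⟨n, hn, U, hU⟩ := h
  obtain ⟨f, hf⟩ := exists_ne (0 : H)
  refine ⟨n, hn, U, f, hf, fun a => ⟨fun ha => ?_, fun ha => ?_⟩⟩
  · have := tendsto_toWeakSpace_iff.1 ((hU f a).1 ha) f
    rw [inner_self_eq_norm_sq_to_K] at this
    simpa using this
  · simpa using tendsto_toWeakSpace_iff.1 ((hU f a).2 ha) f

lemma IsRigidityGroup.relationModule_le (h : IsRigidityGroup H φ G) :
    ∀ a ∈ relationModule φ, a ∈ G := by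
  obtain ⟨n, hn, U, hU⟩ := h
  intro a ha
  rw [← SetLike.mem_coe, hU]
  intro f
  refine tendsto_const_nhds.congr' ?_
  filter_upwards [hn.tendsto_atTop.eventually (mem_relationModule.1 ha)] with k hk
  simp [hk]

lemma HasCorrelationDichotomy.relationModule_le (h : HasCorrelationDichotomy H φ G) :
    ∀ a ∈ relationModule φ, a ∈ G := by
  obtain ⟨n, hn, U, f, hf, hU⟩ := h
  intro a ha
  by_contra haG
  have h1 : Tendsto (fun k => inner ℂ ((U ^ linComb φ a (n k)) f) f) atTop (𝓝 (inner ℂ f f)) := by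
    refine tendsto_const_nhds.congr' ?_
    filter_upwards [hn.tendsto_atTop.eventually (mem_relationModule.1 ha)] with k hk
    simp [hk]
  exact hf (inner_self_eq_zero.1 (tendsto_nhds_unique h1 ((hU a).2 haG)))

end

theorem corollary3 {H : Type*} [NormedAddCommGroup H] [InnerProductSpace ℂ H] [CompleteSpace H]
    (hH : ¬ FiniteDimensional ℂ H)
    {ℓ : ℕ} (hℓ : 0 < ℓ) (φ : Fin ℓ → ℕ → ℤ) (hφ : Adequate φ)
    (G : AddSubgroup (Fin ℓ → ℤ)) :
    List.TFAE [IsRigidityGroup H φ G, HasWeakDichotomy H φ G, HasCorrelationDichotomy H φ G] := by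
  have : Nontrivial H := by
    by_contra h
    have := not_nontrivial_iff_subsingleton.1 h
    exact hH inferInstance
  tfae_have 1 → 2 := fun h => hasWeakDichotomy_of_relationModule_le hH hφ h.relationModule_le
  tfae_have 2 → 1 := fun h => h.isRigidityGroup
  tfae_have 2 → 3 := fun h => h.hasCorrelationDichotomy
  tfae_have 3 → 2 := fun h => hasWeakDichotomy_of_relationModule_le hH hφ h.relationModule_le
  tfae_finish
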